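/- Let $\mathcal A$ be a unital $C^*$-algebra, $\varphi$ a tracial state on $\mathcal A$, $f\in\mathcal S(\mathbb R)$ a complex-valued Schwartz function, and $a,b,x,y\in\mathcal A$ selfadjoint. Notation. Let $\mathcal A^{\otimes(n+1)}_\gamma$ be the projective tensor product completion of $\mathcal A^{\otimes(n+1)}$. For selfadjoint $c\in\mathcal A$ let $c^{(j)}\in\mathcal A^{\otimes (n+1)}_\gamma$ ($0\le j\le n$) be the elementary tensor with $c$ in slot $j$ and $1$ in all other slots, and put $\nabla^{(j)}_c=-c^{(j-1)}+c^{(j)}$ ($1\le j\le n$), $\nabla_c=\nabla_c^{(1)}$ for $n=1$. For $F$ smooth in a neighbourhood of $(\operatorname{spec} c)^{n+1}$, the element $F_\gamma(c^{(0)},\dots,c^{(n)})\in\mathcal A^{\otimes(n+1)}_\gamma$ is defined by the smooth functional calculus: it equals the Bochner integral $\int_{\mathbb R^{n+1}}\widehat G(\xi)\, e^{2\pi i\xi_0c}\otimes\cdots\otimes e^{2\pi i\xi_nc}\,d\xi$, with $\widehat G(\xi)=\int_{\mathbb R^{n+1}} G(t)e^{-2\pi i\langle\xi,t\rangle}\,dt$,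 for any Schwartz function $G$ on $\mathbb R^{n+1}$ that agrees with $F$ near $(\operatorname{spec} c)^{n+1}$. For a smooth function $F$ of $n$ variables, $F_\gamma(\nabla^{(1)}_c,\dots,\nabla^{(n)}_c)$ is this calculus applied to $(t_0,\dots,t_n)\mapsto F(t_1-t_0,\dots,t_n-t_{n-1})$. For $T\in\mathcal A^{\otimes(n+1)}_\gamma$ and $b_1,\dots,b_n\in\mathcal A$, the contraction $T(b_1\cdots b_n)\in\mathcal A$ is the continuous linear extension in $T$ of $(a_0\otimes\cdots\otimes a_n)(b_1\cdots b_n)=a_0b_1a_1b_2\cdots b_na_n$. Let $[u,v]f=\frac{f(u)-f(v)}{u-v}$ for $u\ne v$ and $[u,u]f=f'(u)$. Then $f(\nabla_c)$ is $F_\gamma(\nabla_c)$ with $F=f$, and $[\nabla^{(1)}_a,-\nabla^{(2)}_a]f_\gamma$, $[-\nabla^{(1)}_a,\nabla^{(2)}_a]f_\gamma\in\mathcal A^{\otimes 3}_\gamma$ are $F_\gamma(\nabla^{(1)}_a,\nabla^{(2)}_a)$ for $F(s,t)=[s,-t]f$ and $F(s,t)=[-s,t]f$, respectively. Claim. The function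 $\varepsilon\mapsto\varphi\bigl(f(\nabla_{a+\varepsilon b})(x)\,y\bigr)$ of $\varepsilon\in\mathbb R$ is differentiable at $0$ and $$\frac{d}{d\varepsilon}\Big|_{\varepsilon=0}\varphi\bigl(f(\nabla_{a+\varepsilon b})(x)\,y\bigr)=-\varphi\Bigl(b\,\bigl([\nabla^{(1)}_a,-\nabla^{(2)}_a]f_\gamma\bigr)(x\cdot y)\Bigr)+\varphi\Bigl(b\,\bigl([-\nabla^{(1)}_a,\nabla^{(2)}_a]f_\gamma\bigr)(y\cdot x)\Bigr).$$ Moreover, for all real $s,t$ with $s+t\neq0$, $$-[s,-t]f=\frac{f(-t)-f(s)}{s+t},\qquad [-s,t]f=\frac{f(t)-f(-s)}{s+t}.$$ -/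

import Mathlib

open scoped SchwartzMap FourierTransform TensorProduct Topology ComplexOrder

noncomputable section

namespace NablaCalculus

/-- A tracial state on a unital C*-algebra: a positive linear functional `φ` with `φ 1 = 1` and
`φ (x y) = φ (y x)`. -/
structure IsTracialState {A : Type*} [CStarAlgebra A] (φ : A →ₗ[ℂ] ℂ) : Prop where
  nonneg : ∀ x : A, 0 ≤ φ (star x * x)
  map_one : φ 1 = 1
  tracial : ∀ x y : A, φ (x * y) = φ (y * x)

/-- The projective tensor product completion of the `m`-fold algebraic tensor power of `A`.
(The norm that Mathlib puts on `⨂[ℂ] _ : Fin m, A` is the projective seminorm.) -/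
abbrev ProjTensor (A : Type*) [CStarAlgebra A] (m : ℕ) : Type _ :=
  UniformSpace.Completion (⨂[ℂ] _ : Fin m, A)

variable {A : Type*} [CStarAlgebra A] {n : ℕ}

/-- The multilinear map `(a₀, …, aₙ) ↦ μₙ ((a₀ ⊗ ⋯ ⊗ aₙ) (b₁ ⊗ ⋯ ⊗ bₙ ⊗ 1))`, where `μₙ` is the
multiplication map, that is `(a₀, …, aₙ) ↦ a₀ b₁ a₁ b₂ ⋯ bₙ aₙ`. The entries of `b` are indexed
from `0`. -/
def contractMultilinear (b : Fin n → A) :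
    ContinuousMultilinearMap ℂ (fun _ : Fin (n + 1) => A) A :=
  (ContinuousMultilinearMap.mkPiAlgebraFin ℂ (n + 1) A).compContinuousLinearMap
    fun j => (ContinuousLinearMap.mul ℂ A).flip (Fin.snoc (α := fun _ => A) b 1 j)

/-- Contraction `T ↦ T (b₁ ⋯ bₙ)` of an element of the projective tensor power with
`b₁ ⊗ ⋯ ⊗ bₙ`: the continuous linear extension of `a₀ ⊗ ⋯ ⊗ aₙ ↦ a₀ b₁ a₁ b₂ ⋯ bₙ aₙ`. -/
def contract (b : Fin n → A) : ProjTensor A (n + 1) →L[ℂ] A :=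
  (PiTensorProduct.liftIsometry ℂ (fun _ : Fin (n + 1) => A) A
    (contractMultilinear b)).extend UniformSpace.Completion.toComplL

/-- The contraction on elementary tensors is `a₀ b₁ a₁ b₂ ⋯ bₙ aₙ`. -/
theorem contract_tprod (b : Fin n → A) (p : Fin (n + 1) → A) :
    contract b ((⨂ₜ[ℂ] j, p j : ⨂[ℂ] _ : Fin (n + 1), A) : ProjTensor A (n + 1)) =
      (List.ofFn fun j : Fin n => p j.castSucc * b j).prod * p (Fin.last n) := by
  have h := ContinuousLinearMap.extend_eq
    (PiTensorProduct.liftIsometry ℂ (fun _ : Fin (n + 1) => A) A (contractMultilinear b))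
    (e := UniformSpace.Completion.toComplL (𝕜 := ℂ)) UniformSpace.Completion.denseRange_coe
    (UniformSpace.Completion.isUniformInducing_coe _) (⨂ₜ[ℂ] j, p j)
  refine Eq.trans h ?_
  simp [contractMultilinear, List.ofFn_succ', List.concat_eq_append, -List.ofFn_succ]

/-- The element `exp (2πi (ξ₀ a⁽⁰⁾ + ⋯ + ξₙ a⁽ⁿ⁾)) = exp (2πi ξ₀ a) ⊗ ⋯ ⊗ exp (2πi ξₙ a)`,
where `a⁽ʲ⁾` is `a` put into the `j`-th slot. -/
def expTensor (a : A) (ξ : EuclideanSpace ℝ (Fin (n + 1))) : ProjTensor A (n + 1) :=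
  ((⨂ₜ[ℂ] j, NormedSpace.exp ((2 * Real.pi * Complex.I * (ξ j : ℂ)) • a) :
    ⨂[ℂ] _ : Fin (n + 1), A) : ProjTensor A (n + 1))

/-- `G(a⁽⁰⁾, …, a⁽ⁿ⁾)` for a Schwartz function `G`, by Fourier inversion, as a Bochner integral
in the projective tensor power. -/
def schwartzCalc (a : A) (G : 𝓢(EuclideanSpace ℝ (Fin (n + 1)), ℂ)) : ProjTensor A (n + 1) :=
  ∫ ξ, (𝓕 G) ξ • expTensor a ξ

/-- `(spec a)ⁿ⁺¹` as a subset of `ℝⁿ⁺¹` (for self-adjoint `a`). -/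
def specPow (a : A) (n : ℕ) : Set (EuclideanSpace ℝ (Fin (n + 1))) :=
  {x | ∀ j, x j ∈ spectrum ℝ a}

open Classical in
/-- The smooth functional calculus `F ↦ F(a⁽⁰⁾, …, a⁽ⁿ⁾)` with values in the projective tensor
power: take a Schwartz function which agrees with `F` in a neighbourhood of `(spec a)ⁿ⁺¹` (it
exists if `F` is smooth near that compact set, and the result does not depend on it for
self-adjoint `a`). -/
def smoothCalc (a : A) (F : EuclideanSpace ℝ (Fin (n + 1)) → ℂ) : ProjTensor A (n + 1) :=
  if h : ∃ G : 𝓢(EuclideanSpace ℝ (Fin (n + 1)), ℂ), F =ᶠ[𝓝ˢ (specPow a n)] G then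
    schwartzCalc a h.choose
  else 0

/-- `F(∇⁽¹⁾, …, ∇⁽ⁿ⁾)` for a function `F` of `n` variables, where `∇⁽ʲ⁾ = -a⁽ʲ⁻¹⁾ + a⁽ʲ⁾` for
`1 ≤ j ≤ n`. The variables of `F` are indexed from `0`. -/
def nablaCalc (a : A) (F : (Fin n → ℝ) → ℂ) : ProjTensor A (n + 1) :=
  smoothCalc a fun x => F fun j => -x j.castSucc + x j.succ

/-- The divided difference `[u, v] f`, that is `(f u - f v) / (u - v)` if `u ≠ v` and `f' u` if
`u = v`. -/
def divDiff (f : ℝ → ℂ) (u v : ℝ) : ℂ := dslope f u v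

end NablaCalculus

end

/-! Write `E(s)` for `exp(2πi s a)`. By Fourier inversion `f(∇_a)(x) = ∫ f̂(ξ) E(-ξ) x E(ξ) dξ`.
Duhamel's formula differentiates each exponential in `ε`: the derivative of `exp(2πi s (a + εb))` at
`0` is `2πi s` times an average over `θ ∈ [0,1]` of `E((1-θ)s) b E(θs)`. The trace cycles `b` to the
front, and `2πi ξ f̂(ξ)` is the Fourier transform of `f'`. On the other side, `[u,w]f = ∫₀¹ f'(θu +
(1-θ)w) dθ`, so Fourier inversion for `f'` turns both contractions into the same double integrals
over `ξ` and `θ`.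

The delicate point is that `f(t₁ - t₀)` and the divided differences are not Schwartz functions of
the `tⱼ`, while the calculus is defined through an arbitrary Schwartz extension.
`contract_smoothCalc` bridges this: if a smooth `F` is the Fourier transform of a finite complex
measure, that measure may replace the transform of the extension. The reason is a reproducing
formula: if `χ = 1` on the spectrum, then `E(s) = ∫ χ̂(ζ - s) E(ζ) dζ`. Inserted in every slot, it
shows that an integral of exponentials sees its symbol only where `∏ χ(tⱼ) ≠ 0`. -/

noncomputable section

open scoped ContDiff

namespace NablaCalculus

open MeasureTheory Real

/-! ### Unitary one-parameter groups and Duhamel's formula -/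

section

variable {A : Type*} [CStarAlgebra A]

/-- The one-parameter group `s ↦ exp (2πi s a)`. -/
def expGroup (a : A) (s : ℝ) : A := NormedSpace.exp ((2 * π * Complex.I * (s : ℂ)) • a)

theorem continuous_expGroup_uncurry : Continuous fun p : A × ℝ => expGroup p.1 p.2 := by
  unfold expGroup
  let _ : NormedAlgebra ℚ A := NormedAlgebra.restrictScalars ℚ ℂ A
  exact NormedSpace.exp_continuous.comp (by fun_prop)

@[fun_prop]
theorem Continuous.expGroup {X : Type*} [TopologicalSpace X] {u : X → A} {s : X → ℝ}
    (hu : Continuous u) (hs : Continuous s) : Continuous fun x => expGroup (u x) (s x) :=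
  continuous_expGroup_uncurry.comp (hu.prodMk hs)

theorem expGroup_eq_exp_smul (a : A) (s : ℝ) :
    expGroup a s = NormedSpace.exp (s • ((2 * π * Complex.I : ℂ) • a)) := by
  rw [expGroup, ← Complex.coe_smul, smul_smul, mul_comm]

theorem expGroup_zero (a : A) : expGroup a 0 = 1 := by
  simp [expGroup]

theorem expGroup_add (a : A) (s t : ℝ) : expGroup a (s + t) = expGroup a s * expGroup a t := by
  let _ : NormedAlgebra ℚ A := NormedAlgebra.restrictScalars ℚ ℂ A
  unfold expGroup
  rw [← NormedSpace.exp_add_of_commute]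
  · congr 1
    push_cast
    rw [← add_smul]
    ring_nf
  · exact ((Commute.refl a).smul_left _).smul_right _

theorem norm_expGroup_le_one {a : A} (ha : IsSelfAdjoint a) (s : ℝ) : ‖expGroup a s‖ ≤ 1 := by
  have hs : IsSelfAdjoint ((2 * π * s) • a) := (IsSelfAdjoint.all (2 * π * s)).smul ha
  have h : expGroup a s = NormedSpace.exp (Complex.I • ((2 * π * s) • a)) := by
    rw [expGroup, ← Complex.coe_smul, smul_smul]
    congr 2
    push_cast
    ring
  rw [h]
  nontriviality A
  -- The exponent is `i` times a selfadjoint element, so the exponential is unitary.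
  refine (CStarRing.norm_of_mem_unitary ?_).le
  exact (selfAdjoint.expUnitary (⟨_, hs⟩ : selfAdjoint A)).2

theorem hasDerivAt_expGroup (a : A) (s : ℝ) :
    HasDerivAt (expGroup a) (expGroup a s * ((2 * π * Complex.I : ℂ) • a)) s := by
  have h := hasDerivAt_exp_smul_const (𝕂 := ℝ) ((2 * π * Complex.I : ℂ) • a) s
  simp only [← expGroup_eq_exp_smul] at h
  exact h

theorem hasDerivAt_expGroup' (a : A) (s : ℝ) :
    HasDerivAt (expGroup a) (((2 * π * Complex.I : ℂ) • a) * expGroup a s) s := by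
  have h := hasDerivAt_exp_smul_const' (𝕂 := ℝ) ((2 * π * Complex.I : ℂ) • a) s
  simp only [← expGroup_eq_exp_smul] at h
  exact h

/-- Duhamel's formula. -/
theorem expGroup_sub_expGroup (a c : A) (s : ℝ) :
    expGroup c s - expGroup a s = ∫ u in (0 : ℝ)..1, (2 * π * Complex.I * s : ℂ) •
      (expGroup c (u * s) * (c - a) * expGroup a ((1 - u) * s)) := by
  have h : ∀ u ∈ Set.uIcc (0 : ℝ) 1,
      HasDerivAt (fun u : ℝ => expGroup c (u * s) * expGroup a ((1 - u) * s))
      ((2 * π * Complex.I * s : ℂ) •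
        (expGroup c (u * s) * (c - a) * expGroup a ((1 - u) * s))) u := by
    intro u _
    have h1 := (hasDerivAt_expGroup c (u * s)).scomp u ((hasDerivAt_id u).mul_const s)
    have h2 := (hasDerivAt_expGroup' a ((1 - u) * s)).scomp u
      (((hasDerivAt_id u).const_sub 1).mul_const s)
    refine (h1.mul h2).congr_deriv ?_
    simp only [Function.comp_apply, id, one_mul, neg_mul, ← Complex.coe_smul, smul_smul,
      smul_mul_assoc, mul_smul_comm, neg_smul, mul_sub, sub_mul, smul_sub, mul_assoc, mul_neg]
    rw [← sub_eq_add_neg]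
    congr 2 <;> ring
  rw [intervalIntegral.integral_eq_sub_of_hasDerivAt h]
  · simp [expGroup_zero]
  · exact (by fun_prop : Continuous _).intervalIntegrable _ _

theorem norm_expGroup_sub_le {a c : A} (ha : IsSelfAdjoint a) (hc : IsSelfAdjoint c) (s : ℝ) :
    ‖expGroup c s - expGroup a s‖ ≤ 2 * π * |s| * ‖c - a‖ := by
  rw [expGroup_sub_expGroup]
  refine (intervalIntegral.norm_integral_le_of_norm_le_const
    (C := 2 * π * |s| * ‖c - a‖) fun u _ => ?_).trans_eq (by simp)
  rw [norm_smul]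
  have h : ‖expGroup c (u * s) * (c - a) * expGroup a ((1 - u) * s)‖ ≤ ‖c - a‖ := by
    calc _ ≤ ‖expGroup c (u * s)‖ * ‖c - a‖ * ‖expGroup a ((1 - u) * s)‖ := norm_mul₃_le
      _ ≤ 1 * ‖c - a‖ * 1 := by
        gcongr
        · exact norm_expGroup_le_one hc _
        · exact norm_expGroup_le_one ha _
      _ = ‖c - a‖ := by ring
  have h2 : ‖(2 * π * Complex.I * s : ℂ)‖ = 2 * π * |s| := by
    simp [abs_of_pos Real.pi_pos]
  rw [h2]
  gcongr

/-- In Duhamel's formula with `c = a + εb` the factor `c - a = εb` cancels the `ε⁻¹` of the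
difference quotient; what remains is continuous in `ε`, also at `0`. -/
theorem hasDerivAt_expGroup_add_smul (a b : A) (s : ℝ) :
    HasDerivAt (fun ε : ℝ => expGroup (a + ε • b) s)
      (∫ u in (0 : ℝ)..1, (2 * π * Complex.I * s : ℂ) •
        (expGroup a (u * s) * b * expGroup a ((1 - u) * s))) 0 := by
  rw [hasDerivAt_iff_tendsto_slope_zero]
  have hc : Continuous fun ε : ℝ => ∫ u in (0 : ℝ)..1, (2 * π * Complex.I * s : ℂ) •
        (expGroup (a + ε • b) (u * s) * b * expGroup a ((1 - u) * s)) :=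
    intervalIntegral.continuous_parametric_intervalIntegral_of_continuous' (by fun_prop) 0 1
  have h := (hc.tendsto 0).mono_left (nhdsWithin_le_nhds (s := {0}ᶜ))
  simp only [zero_smul, add_zero] at h
  refine h.congr' ?_
  filter_upwards [self_mem_nhdsWithin] with ε hε
  have hε : ε ≠ 0 := hε
  simp only [zero_add, zero_smul, add_zero]
  rw [expGroup_sub_expGroup, ← intervalIntegral.integral_smul]
  refine intervalIntegral.integral_congr fun u _ => ?_
  simp only [add_sub_cancel_left, mul_smul_comm, smul_mul_assoc]
  rw [smul_comm ε⁻¹, smul_smul ε⁻¹, inv_mul_cancel₀ hε, one_smul]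

namespace IsTracialState

/-- Positive functionals on a C*-algebra are bounded. The spectral order is put on `A` only to
express positivity. -/
theorem continuous {φ : A →ₗ[ℂ] ℂ} (hφ : IsTracialState φ) : Continuous φ := by
  let _ := CStarAlgebra.spectralOrder A
  let _ := CStarAlgebra.spectralOrderedRing A
  let P : A →ₚ[ℂ] ℂ := PositiveLinearMap.mk₀ φ fun x hx => by
    obtain ⟨y, rfl⟩ := CStarAlgebra.nonneg_iff_eq_star_mul_self.1 hx
    exact hφ.nonneg y
  obtain ⟨C, hC⟩ := P.exists_norm_apply_le
  exact AddMonoidHomClass.continuous_of_bound φ C hC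

end IsTracialState

end

/-! ### Fubini for multilinear maps and the reproducing formula -/

section

section Multilinear

variable {E F : Type*} [NormedAddCommGroup E] [NormedSpace ℂ E]
  [NormedAddCommGroup F] [NormedSpace ℂ F]

theorem integrable_multilinear {m : ℕ}
    (M : ContinuousMultilinearMap ℂ (fun _ : Fin m => E) F) (f : Fin m → ℝ → E)
    (hf : ∀ j, Integrable (f j)) (hc : ∀ j, Continuous (f j)) :
    Integrable fun t : Fin m → ℝ => M fun j => f j (t j) := by
  refine ((Integrable.fintype_prod (𝕜 := ℝ) (f := fun j t => ‖f j t‖)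
    (μ := fun _ => volume) fun j => (hf j).norm).const_mul ‖M‖).mono'
    (M.cont.comp (by fun_prop)).aestronglyMeasurable ?_
  exact .of_forall fun t => M.le_opNorm _

/-- Fubini, splitting off the first variable through `curryLeft`. -/
theorem integral_multilinear [CompleteSpace E] [CompleteSpace F] {m : ℕ}
    (M : ContinuousMultilinearMap ℂ (fun _ : Fin m => E) F) (f : Fin m → ℝ → E)
    (hf : ∀ j, Integrable (f j)) (hc : ∀ j, Continuous (f j)) :
    ∫ t : Fin m → ℝ, M (fun j => f j (t j)) = M fun j => ∫ t, f j t := by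
  induction m with
  | zero =>
    simp only [Subsingleton.elim _ (0 : Fin 0 → E)]
    simp [measureReal_def, volume_pi]
  | succ m ih =>
    have hmp := (volume_preserving_piFinSuccAbove (fun _ : Fin (m + 1) => ℝ) 0).symm
    have hcons : ∀ p : ℝ × (Fin m → ℝ),
        M (fun j => f j ((MeasurableEquiv.piFinSuccAbove (fun _ => ℝ) 0).symm p j)) =
          M.curryLeft (f 0 p.1) fun j => f j.succ (p.2 j) := by
      intro p
      rw [ContinuousMultilinearMap.curryLeft_apply]
      congr 1
      funext j
      refine Fin.cases ?_ (fun i => ?_) j <;>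
        simp [MeasurableEquiv.piFinSuccAbove_symm_apply, Fin.insertNthEquiv]
    have hint := integrable_multilinear M f hf hc
    rw [← hmp.integrable_comp_emb (MeasurableEquiv.measurableEmbedding _)] at hint
    rw [← hmp.integral_comp']
    simp only [Function.comp_def] at hint
    simp only [hcons] at hint ⊢
    rw [Measure.volume_eq_prod] at hint ⊢
    rw [integral_prod _ hint]
    simp only [fun t : ℝ => ih (M.curryLeft (f 0 t)) (fun j => f j.succ) (fun j => hf _)
      fun j => hc _]
    have h := ContinuousLinearMap.integral_comp_comm
      ((ContinuousMultilinearMap.apply ℂ (fun _ : Fin m => E) F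
        fun j => ∫ t, f j.succ t).comp M.curryLeft) (hf 0)
    simp only [ContinuousLinearMap.comp_apply, ContinuousMultilinearMap.apply_apply] at h
    rw [h, ContinuousMultilinearMap.curryLeft_apply]
    congr 1
    funext j
    refine Fin.cases ?_ (fun i => ?_) j <;> simp

end Multilinear

variable {A : Type*} [CStarAlgebra A]

theorem expGroup_eq_cfc {a : A} (ha : IsSelfAdjoint a) (s : ℝ) :
    expGroup a s = cfc (fun z : ℂ => Complex.exp (2 * π * Complex.I * s * z)) a := by
  have hn : IsStarNormal a := ha.isStarNormal
  have hn' : IsStarNormal ((2 * π * Complex.I * (s : ℂ)) • a) := by infer_instance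
  rw [expGroup, ← CFC.complex_exp_eq_normedSpace_exp hn']
  rw [← cfc_comp_smul (2 * π * Complex.I * (s : ℂ)) Complex.exp a
    (Complex.continuous_exp.continuousOn) hn]
  simp only [smul_eq_mul]

theorem norm_cexp_two_pi_mul (x y : ℝ) : ‖Complex.exp (2 * π * Complex.I * x * y)‖ = 1 := by
  rw [show (2 * π * Complex.I * x * y : ℂ) = ((2 * π * x * y : ℝ) : ℂ) * Complex.I by
    push_cast; ring]
  exact Complex.norm_exp_ofReal_mul_I _

theorem _root_.SchwartzMap.integral_fourier_mul_cexp (χ : 𝓢(ℝ, ℂ)) (t : ℝ) :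
    ∫ η : ℝ, (𝓕 χ) η * Complex.exp (2 * π * Complex.I * η * t) = χ t := by
  have h : 𝓕⁻ (𝓕 χ) = χ := FourierPair.fourierInv_fourier_eq χ
  conv_rhs => rw [← h, SchwartzMap.fourierInv_coe, Real.fourierInv_eq']
  refine integral_congr_ae (.of_forall fun η => ?_)
  simp only [smul_eq_mul, RCLike.inner_apply, conj_trivial]
  rw [mul_comm]
  congr 2
  push_cast
  ring

/-- The functional calculus of a Schwartz function that is `1` on the spectrum. -/
theorem integral_fourier_smul_expGroup {a : A} (ha : IsSelfAdjoint a) (χ : 𝓢(ℝ, ℂ))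
    (hχ : ∀ t ∈ spectrum ℝ a, χ t = 1) :
    ∫ η : ℝ, (𝓕 χ) η • expGroup a η = 1 := by
  have hn : IsStarNormal a := ha.isStarNormal
  have hre : ∀ z ∈ spectrum ℂ a, ∃ t ∈ spectrum ℝ a, z = (t : ℂ) := fun z hz => by
    refine ⟨z.re, ?_, ?_⟩
    · rw [← spectrum.algebraMap_mem_iff ℂ, Complex.coe_algebraMap, ← ha.mem_spectrum_eq_re hz]
      exact hz
    · exact ha.mem_spectrum_eq_re hz
  -- The dominating function `‖𝓕 χ‖` works because the spectrum is real, where the exponentials have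
  -- modulus `1`.
  have key := cfc_integral (μ := (volume : Measure ℝ)) (𝕜 := ℂ)
    (fun η z => (𝓕 χ) η * Complex.exp (2 * π * Complex.I * η * z))
    (fun η => ‖(𝓕 χ) η‖) a
    (Continuous.continuousOn (by
      have := (𝓕 χ).continuous
      simp only [Function.uncurry_def]
      fun_prop))
    (.of_forall fun η z hz => by
      obtain ⟨t, -, rfl⟩ := hre z hz
      rw [norm_mul, norm_cexp_two_pi_mul, mul_one])
    (𝓕 χ).integrable.norm.2 hn
  have h1 : (fun η : ℝ => (𝓕 χ) η • expGroup a η) = fun η : ℝ =>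
      cfc (fun z : ℂ => (𝓕 χ) η * Complex.exp (2 * π * Complex.I * η * z)) a := by
    funext η
    rw [expGroup_eq_cfc ha, ← cfc_smul _ _ _ (Continuous.continuousOn (by fun_prop))]
    simp only [smul_eq_mul]
  rw [h1, ← key]
  rw [← cfc_one ℂ a hn]
  refine cfc_congr fun z hz => ?_
  obtain ⟨t, ht, rfl⟩ := hre z hz
  simp only [SchwartzMap.integral_fourier_mul_cexp, hχ t ht, Pi.one_apply]

/-- Translating by `s` splits off the factor `E(s)` by the group law, and the remaining integral is
`χ(a) = 1`. -/
theorem integral_fourier_sub_smul_expGroup {a : A} (ha : IsSelfAdjoint a) (χ : 𝓢(ℝ, ℂ))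
    (hχ : ∀ t ∈ spectrum ℝ a, χ t = 1) (s : ℝ) :
    ∫ ζ : ℝ, (𝓕 χ) (ζ - s) • expGroup a ζ = expGroup a s := by
  rw [← integral_add_right_eq_self _ s]
  simp only [add_sub_cancel_right, expGroup_add, ← smul_mul_assoc]
  have hi : Integrable fun ζ : ℝ => (𝓕 χ) ζ • expGroup a ζ :=
    (𝓕 χ).integrable.norm.mono' (by
      have := (𝓕 χ).continuous
      exact (by fun_prop : Continuous _).aestronglyMeasurable) <| .of_forall fun ζ => by
        rw [norm_smul]
        exact mul_le_of_le_one_right (norm_nonneg _) (norm_expGroup_le_one ha _)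
  rw [integral_mul_const_of_integrable hi, integral_fourier_smul_expGroup ha χ hχ, one_mul]

end

/-! ### Integrals of exponentials depend only on the symbol near the spectrum -/

section

variable {A : Type*} [CStarAlgebra A]

theorem _root_.SchwartzMap.fourier_sub_eq_integral (χ : 𝓢(ℝ, ℂ)) (ζ s : ℝ) :
    (𝓕 χ) (ζ - s) = ∫ t : ℝ, χ t * Complex.exp (2 * π * Complex.I * ((-ζ : ℝ) : ℂ) * t) *
      Complex.exp (2 * π * Complex.I * s * t) := by
  rw [SchwartzMap.fourier_coe, Real.fourier_eq']
  refine integral_congr_ae (.of_forall fun t => ?_)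
  simp only [smul_eq_mul, RCLike.inner_apply, conj_trivial]
  rw [mul_assoc (χ t), ← Complex.exp_add, mul_comm]
  congr 2
  push_cast
  ring

variable {W : Type*} [MeasurableSpace W] {μ : Measure W} [SFinite μ] {m : ℕ}

/-- The Fourier transform of the image under `η` of the measure with density `g`. -/
def fourierDual (μ : Measure W) (g : W → ℂ) (η : W → Fin m → ℝ) (t : Fin m → ℝ) : ℂ :=
  ∫ w, g w * ∏ j, Complex.exp (2 * π * Complex.I * η w j * t j) ∂μ

/-- A convolution theorem: smearing the measure by `∏ χ̂` multiplies its transform by `∏ χ(tⱼ)`. -/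
theorem integral_mul_prod_fourier_sub (χ : 𝓢(ℝ, ℂ)) {g : W → ℂ} (hg : Integrable g μ)
    {η : W → Fin m → ℝ} (hη : Measurable η) (ζ : Fin m → ℝ) :
    ∫ w, g w * ∏ j, (𝓕 χ) (ζ j - η w j) ∂μ =
      ∫ t : Fin m → ℝ, (∏ j, χ (t j) *
        Complex.exp (2 * π * Complex.I * ((-ζ j : ℝ) : ℂ) * t j)) * fourierDual μ g η t := by
  have h1 : ∀ w, g w * ∏ j, (𝓕 χ) (ζ j - η w j) = ∫ t : Fin m → ℝ, g w *
      ((∏ j, χ (t j) * Complex.exp (2 * π * Complex.I * ((-ζ j : ℝ) : ℂ) * t j)) *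
        ∏ j, Complex.exp (2 * π * Complex.I * η w j * t j)) := by
    intro w
    rw [integral_const_mul]
    congr 1
    simp only [SchwartzMap.fourier_sub_eq_integral, ← Finset.prod_mul_distrib]
    rw [← integral_fintype_prod_volume_eq_prod (fun (j : Fin m) (t : ℝ) =>
      χ t * Complex.exp (2 * π * Complex.I * ((-ζ j : ℝ) : ℂ) * t) *
        Complex.exp (2 * π * Complex.I * η w j * t))]
  simp only [h1]
  rw [integral_integral_swap]
  · refine integral_congr_ae (.of_forall fun t => ?_)
    simp only [fourierDual]
    rw [← integral_const_mul]
    refine integral_congr_ae (.of_forall fun w => ?_)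
    simp only
    ring
  · have hp : Integrable fun t : Fin m → ℝ => ∏ j, ‖χ (t j)‖ :=
      Integrable.fintype_prod (𝕜 := ℝ) (f := fun (j : Fin m) t => ‖χ t‖)
        (μ := fun _ => volume) fun j => χ.integrable.norm
    refine (hg.norm.mul_prod hp).mono' ?_ (.of_forall fun p => ?_)
    · refine hg.1.comp_fst.mul (Measurable.aestronglyMeasurable ?_)
      have := χ.continuous.measurable
      fun_prop
    · simp only [Function.uncurry, norm_mul, norm_prod, norm_cexp_two_pi_mul, mul_one,
        Finset.prod_const_one, le_refl]

variable {F : Type*} [NormedAddCommGroup F] [NormedSpace ℂ F]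

theorem norm_multilinear_expGroup_le {a : A} (ha : IsSelfAdjoint a)
    (M : ContinuousMultilinearMap ℂ (fun _ : Fin m => A) F) (ζ : Fin m → ℝ) :
    ‖M fun j => expGroup a (ζ j)‖ ≤ ‖M‖ := by
  refine (M.le_opNorm _).trans (mul_le_of_le_one_right (norm_nonneg _) ?_)
  exact Finset.prod_le_one (fun _ _ => norm_nonneg _) fun j _ => norm_expGroup_le_one ha _

variable [CompleteSpace F]

theorem multilinear_expGroup_eq_integral {a : A} (ha : IsSelfAdjoint a) (χ : 𝓢(ℝ, ℂ))
    (hχ : ∀ t ∈ spectrum ℝ a, χ t = 1)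
    (M : ContinuousMultilinearMap ℂ (fun _ : Fin m => A) F) (s : Fin m → ℝ) :
    M (fun j => expGroup a (s j)) =
      ∫ ζ : Fin m → ℝ, (∏ j, (𝓕 χ) (ζ j - s j)) • M fun j => expGroup a (ζ j) := by
  have hF := (𝓕 χ).continuous
  have h := integral_multilinear M (fun j ζ => (𝓕 χ) (ζ - s j) • expGroup a ζ)
    (fun j => ((𝓕 χ).integrable.comp_sub_right (s j)).norm.mono'
      (by fun_prop : Continuous _).aestronglyMeasurable <| .of_forall fun ζ => by
        rw [norm_smul]
        exact mul_le_of_le_one_right (norm_nonneg _) (norm_expGroup_le_one ha _))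
    (fun j => by fun_prop)
  simp only [integral_fourier_sub_smul_expGroup ha χ hχ] at h
  rw [← h]
  simp only [M.map_smul_univ]

/-- The reproducing formula in every slot, followed by Fubini. On the right, `g` and `η` enter only
through `∏ χ(tⱼ)` times `fourierDual`. -/
theorem integral_smul_multilinear_expGroup {a : A} (ha : IsSelfAdjoint a) (χ : 𝓢(ℝ, ℂ))
    (hχ : ∀ t ∈ spectrum ℝ a, χ t = 1)
    (M : ContinuousMultilinearMap ℂ (fun _ : Fin m => A) F)
    {g : W → ℂ} (hg : Integrable g μ) {η : W → Fin m → ℝ} (hη : Measurable η) :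
    ∫ w, g w • M (fun j => expGroup a (η w j)) ∂μ =
      ∫ ζ : Fin m → ℝ, (∫ t : Fin m → ℝ, (∏ j, χ (t j) *
        Complex.exp (2 * π * Complex.I * ((-ζ j : ℝ) : ℂ) * t j)) * fourierDual μ g η t) •
          M fun j => expGroup a (ζ j) := by
  have hF := (𝓕 χ).continuous
  have hME : Continuous fun ζ : Fin m → ℝ => M fun j => expGroup a (ζ j) :=
    M.cont.comp (by fun_prop)
  have h1 : ∀ w, g w • M (fun j => expGroup a (η w j)) = ∫ ζ : Fin m → ℝ,
      (g w * ∏ j, (𝓕 χ) (ζ j - η w j)) • M fun j => expGroup a (ζ j) := fun w => by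
    rw [multilinear_expGroup_eq_integral ha χ hχ M (η w), ← integral_smul]
    simp only [smul_smul]
  simp only [h1]
  have hp : Integrable fun t : Fin m → ℝ => ∏ j, ‖(𝓕 χ) (t j)‖ :=
      Integrable.fintype_prod (𝕜 := ℝ) (f := fun (j : Fin m) t => ‖(𝓕 χ) t‖)
        (μ := fun _ => volume) fun j => (𝓕 χ).integrable.norm
  have hsh : ∀ s : Fin m → ℝ, Integrable fun t : Fin m → ℝ => ∏ j, ‖(𝓕 χ) (t j - s j)‖ :=
    fun s => hp.comp_sub_right s
  have hmeas : AEStronglyMeasurable (fun p : W × (Fin m → ℝ) =>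
      (g p.1 * ∏ j, (𝓕 χ) (p.2 j - η p.1 j)) • M fun j => expGroup a (p.2 j))
      (μ.prod volume) := by
    refine (hg.1.comp_fst.mul (Measurable.aestronglyMeasurable ?_)).smul
      (hME.comp_stronglyMeasurable measurable_snd.stronglyMeasurable).aestronglyMeasurable
    have := hF.measurable
    fun_prop
  have hle : ∀ (w : W) (ζ : Fin m → ℝ),
      ‖(g w * ∏ j, (𝓕 χ) (ζ j - η w j)) • M fun j => expGroup a (ζ j)‖ ≤
        ‖g w‖ * (∏ j, ‖(𝓕 χ) (ζ j - η w j)‖) * ‖M‖ := fun w ζ => by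
    rw [norm_smul, norm_mul, norm_prod]
    gcongr
    exact norm_multilinear_expGroup_le ha M ζ
  have hbd : ∀ w, Integrable fun ζ : Fin m → ℝ =>
      ‖g w‖ * (∏ j, ‖(𝓕 χ) (ζ j - η w j)‖) * ‖M‖ := fun w =>
    ((hsh (η w)).const_mul _).mul_const _
  rw [integral_integral_swap]
  · refine integral_congr_ae (.of_forall fun ζ => ?_)
    simp only
    rw [integral_smul_const, integral_mul_prod_fourier_sub χ hg hη]
  · simp only [Function.uncurry_def]
    rw [integrable_prod_iff hmeas]
    refine ⟨.of_forall fun w => (hbd w).mono' (Continuous.aestronglyMeasurable (by fun_prop))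
      (.of_forall (hle w)), ?_⟩
    -- By translation invariance the `ζ`-integral of the bound is `‖g w‖` times a constant
    -- independent of `η w`.
    refine (hg.norm.mul_const ((∫ t : Fin m → ℝ, ∏ j, ‖(𝓕 χ) (t j)‖) * ‖M‖)).mono'
      hmeas.norm.integral_prod_right' (.of_forall fun w => ?_)
    rw [Real.norm_of_nonneg (integral_nonneg fun _ => norm_nonneg _)]
    refine (integral_mono_of_nonneg (.of_forall fun _ => norm_nonneg _) (hbd w)
      (.of_forall (hle w))).trans_eq ?_
    rw [integral_mul_const, integral_const_mul, mul_assoc]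
    congr 2
    exact integral_sub_right_eq_self (μ := volume)
      (fun t : Fin m → ℝ => ∏ j, ‖(𝓕 χ) (t j)‖) (η w)

/-- The integral only depends on the values of the Fourier transform near the spectrum. -/
theorem integral_smul_multilinear_expGroup_congr {W' : Type*} [MeasurableSpace W']
    {μ' : Measure W'} [SFinite μ'] {a : A} (ha : IsSelfAdjoint a) (χ : 𝓢(ℝ, ℂ))
    (hχ : ∀ t ∈ spectrum ℝ a, χ t = 1)
    (M : ContinuousMultilinearMap ℂ (fun _ : Fin m => A) F)
    {g : W → ℂ} (hg : Integrable g μ) {η : W → Fin m → ℝ} (hη : Measurable η)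
    {g' : W' → ℂ} (hg' : Integrable g' μ') {η' : W' → Fin m → ℝ} (hη' : Measurable η')
    (h : ∀ t : Fin m → ℝ, (∀ j, χ (t j) ≠ 0) → fourierDual μ g η t = fourierDual μ' g' η' t) :
    ∫ w, g w • M (fun j => expGroup a (η w j)) ∂μ =
      ∫ w, g' w • M (fun j => expGroup a (η' w j)) ∂μ' := by
  rw [integral_smul_multilinear_expGroup ha χ hχ M hg hη,
    integral_smul_multilinear_expGroup ha χ hχ M hg' hη']
  refine integral_congr_ae (.of_forall fun ζ => ?_)
  simp only
  congr 1
  refine integral_congr_ae (.of_forall fun t => ?_)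
  simp only
  by_cases ht : ∀ j, χ (t j) ≠ 0
  · rw [h t ht]
  · push Not at ht
    obtain ⟨j, hj⟩ := ht
    rw [Finset.prod_eq_zero (Finset.mem_univ j) (by rw [hj, zero_mul])]
    simp

end

/-! ### Cutoffs and independence of the Schwartz extension -/

section

theorem exists_contDiff_cutoff {V : Type*} [NormedAddCommGroup V] [NormedSpace ℝ V]
    [FiniteDimensional ℝ V] {K U : Set V} (hK : IsCompact K) (hU : IsOpen U) (hKU : K ⊆ U) :
    ∃ χ : V → ℂ, ContDiff ℝ ∞ χ ∧ HasCompactSupport χ ∧ (∀ᶠ x in 𝓝ˢ K, χ x = 1) ∧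
      ∀ x, χ x ≠ 0 → x ∈ U := by
  obtain ⟨L, hL, hKL, hLU⟩ := exists_compact_between hK hU hKU
  obtain ⟨χ, h1, h0, -⟩ := exists_contMDiffMap_one_nhds_of_subset_interior
    (modelWithCornersSelf ℝ V) (n := ⊤) hK.isClosed hKL
  refine ⟨fun x => χ x, Complex.ofRealCLM.contDiff.comp (contMDiff_iff_contDiff.1 χ.contMDiff),
    ?_, ?_, ?_⟩
  · exact HasCompactSupport.intro hL fun x hx => by simp [h0 x hx]
  · filter_upwards [h1] with x hx
    simp [hx]
  · intro x hx
    by_contra hxU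
    exact hx (by simp [h0 x fun h => hxU (hLU h)])

theorem exists_schwartzMap_eventuallyEq {V : Type*} [NormedAddCommGroup V] [NormedSpace ℝ V]
    [FiniteDimensional ℝ V] {K : Set V} (hK : IsCompact K) {F : V → ℂ} (hF : ContDiff ℝ ∞ F) :
    ∃ G : 𝓢(V, ℂ), F =ᶠ[𝓝ˢ K] G := by
  obtain ⟨χ, hχ, hχc, h1, -⟩ := exists_contDiff_cutoff hK isOpen_univ (Set.subset_univ K)
  refine ⟨(hχc.mul_right (f' := F)).toSchwartzMap (hχ.mul hF), ?_⟩
  filter_upwards [h1] with x hx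
  simp [hx]

/-- This lets a product of copies of one single-variable cutoff be supported in a given
neighbourhood of the power `K^m`. -/
theorem exists_isOpen_pi_subset {m : ℕ} {K : Set ℝ} (hK : IsCompact K) {O : Set (Fin m → ℝ)}
    (hO : IsOpen O) (h : Set.univ.pi (fun _ => K) ⊆ O) :
    ∃ U : Set ℝ, IsOpen U ∧ K ⊆ U ∧ Set.univ.pi (fun _ => U) ⊆ O := by
  obtain ⟨δ, hδ, hsub⟩ :=
    (isCompact_univ_pi fun _ : Fin m => hK).exists_thickening_subset_open hO h
  refine ⟨Metric.thickening δ K, Metric.isOpen_thickening, Metric.self_subset_thickening hδ K,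
    fun t ht => hsub ?_⟩
  have ht' : ∀ j, ∃ s ∈ K, dist (t j) s < δ := fun j =>
    Metric.mem_thickening_iff.1 (ht j (Set.mem_univ j))
  choose s hs hts using ht'
  exact Metric.mem_thickening_iff.2 ⟨s, fun j _ => hs j, (dist_pi_lt_iff hδ).2 hts⟩

variable {A : Type*} [CStarAlgebra A] {n : ℕ}

theorem isCompact_specPow (a : A) (n : ℕ) : IsCompact (specPow a n) := by
  have h := (isCompact_univ_pi fun _ : Fin (n + 1) => spectrum.isCompact (𝕜 := ℝ) a).image
    (PiLp.continuous_toLp 2 fun _ : Fin (n + 1) => ℝ)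
  convert h using 1
  ext x
  constructor
  · exact fun hx => ⟨x.ofLp, fun j _ => hx j, rfl⟩
  · rintro ⟨y, hy, rfl⟩ j
    exact hy j (Set.mem_univ j)

theorem contract_expTensor (b : Fin n → A) (a : A) (ξ : EuclideanSpace ℝ (Fin (n + 1))) :
    contract b (expTensor a ξ) = contractMultilinear b fun j => expGroup a (ξ j) := by
  have h := ContinuousLinearMap.extend_eq
    (PiTensorProduct.liftIsometry ℂ (fun _ : Fin (n + 1) => A) A (contractMultilinear b))
    (e := UniformSpace.Completion.toComplL (𝕜 := ℂ)) UniformSpace.Completion.denseRange_coe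
    (UniformSpace.Completion.isUniformInducing_coe _) (⨂ₜ[ℂ] j, expGroup a (ξ j))
  refine Eq.trans h ?_
  simp

theorem continuous_expTensor (a : A) :
    Continuous (expTensor a : EuclideanSpace ℝ (Fin (n + 1)) → ProjTensor A (n + 1)) := by
  have h : Continuous fun ξ : EuclideanSpace ℝ (Fin (n + 1)) =>
      PiTensorProduct.tprodL ℂ fun j => expGroup a (ξ j) :=
    (PiTensorProduct.tprodL ℂ).cont.comp (by fun_prop)
  exact (UniformSpace.Completion.continuous_coe _).comp h

theorem norm_expTensor_le_one {a : A} (ha : IsSelfAdjoint a)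
    (ξ : EuclideanSpace ℝ (Fin (n + 1))) : ‖expTensor a ξ‖ ≤ 1 := by
  refine (UniformSpace.Completion.norm_coe _).trans_le
    ((PiTensorProduct.projectiveSeminorm_tprod_le _).trans ?_)
  exact Finset.prod_le_one (fun _ _ => norm_nonneg _) fun j _ => norm_expGroup_le_one ha (ξ j)

theorem contract_schwartzCalc {a : A} (ha : IsSelfAdjoint a) (b : Fin n → A)
    (G : 𝓢(EuclideanSpace ℝ (Fin (n + 1)), ℂ)) :
    contract b (schwartzCalc a G) =
      ∫ ξ, (𝓕 G) ξ • contractMultilinear b fun j => expGroup a (ξ j) := by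
  have hi : Integrable fun ξ => (𝓕 G) ξ • expTensor a ξ :=
    (𝓕 G).integrable.norm.mono'
      ((𝓕 G).continuous.smul (continuous_expTensor a)).aestronglyMeasurable
      (.of_forall fun ξ => by
        rw [norm_smul]
        exact mul_le_of_le_one_right (norm_nonneg _) (norm_expTensor_le_one ha ξ))
  rw [schwartzCalc, ← ContinuousLinearMap.integral_comp_comm _ hi]
  simp only [map_smul, contract_expTensor]

theorem fourierDual_fourier {m : ℕ} (G : 𝓢(EuclideanSpace ℝ (Fin m), ℂ))
    (t : EuclideanSpace ℝ (Fin m)) :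
    fourierDual volume (fun ξ => (𝓕 G) ξ) (fun ξ : EuclideanSpace ℝ (Fin m) => ξ.ofLp) t.ofLp =
      G t := by
  have h : 𝓕⁻ (𝓕 G) = G := FourierPair.fourierInv_fourier_eq G
  conv_rhs => rw [← h, SchwartzMap.fourierInv_coe, Real.fourierInv_eq']
  refine integral_congr_ae (.of_forall fun ξ => ?_)
  simp only [smul_eq_mul, PiLp.inner_apply, RCLike.inner_apply, conj_trivial]
  rw [mul_comm, ← Complex.exp_sum]
  congr 2
  push_cast
  rw [Finset.mul_sum, Finset.sum_mul]
  refine Finset.sum_congr rfl fun j _ => ?_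
  ring

/-- The contraction of `F(a⁽⁰⁾, …, a⁽ⁿ⁾)` for a smooth function `F` that is the Fourier transform
of a measure. -/
theorem contract_smoothCalc {W : Type*} [MeasurableSpace W] {μ : Measure W} [SFinite μ]
    {a : A} (ha : IsSelfAdjoint a) (b : Fin n → A)
    {F : EuclideanSpace ℝ (Fin (n + 1)) → ℂ} (hF : ContDiff ℝ ∞ F)
    {g : W → ℂ} (hg : Integrable g μ) {η : W → Fin (n + 1) → ℝ} (hη : Measurable η)
    (h : ∀ t, F t = fourierDual μ g η t.ofLp) :
    contract b (smoothCalc a F) =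
      ∫ w, g w • contractMultilinear b (fun j => expGroup a (η w j)) ∂μ := by
  have hex := exists_schwartzMap_eventuallyEq (isCompact_specPow a n) hF
  rw [smoothCalc, dif_pos hex, contract_schwartzCalc ha]
  -- Nothing is known about the chosen extension except that it equals `F` near the spectrum.
  set G := hex.choose
  have hG : F =ᶠ[𝓝ˢ (specPow a n)] G := hex.choose_spec
  obtain ⟨O, hO, hKO, hOG⟩ := mem_nhdsSet_iff_exists.1 hG
  obtain ⟨U, hU, hKU, hUO⟩ := exists_isOpen_pi_subset (spectrum.isCompact (𝕜 := ℝ) a)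
    (hO.preimage (PiLp.continuous_toLp 2 fun _ : Fin (n + 1) => ℝ))
    (fun t ht => hKO fun j => ht j (Set.mem_univ j))
  obtain ⟨χ, hχ, hχc, hχ1, hχU⟩ := exists_contDiff_cutoff (spectrum.isCompact (𝕜 := ℝ) a) hU hKU
  -- If all `χ(tⱼ)` are nonzero, then `t` lies in `O`, where `G = F`; so the two symbols agree
  -- there.
  refine integral_smul_multilinear_expGroup_congr ha (hχc.toSchwartzMap hχ)
    (fun t ht => hχ1.self_of_nhdsSet t ht) _ (𝓕 G).integrable (by fun_prop) hg hη fun t ht => ?_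
  have htO : WithLp.toLp 2 t ∈ O := hUO fun j _ => hχU _ (ht j)
  have h1 := hOG htO
  rw [Set.mem_ofPred_eq, h] at h1
  exact (fourierDual_fourier G (WithLp.toLp 2 t)).trans h1.symm

end

/-! ### Divided differences: smoothness and Fourier representation -/

section

universe u

theorem hasFDerivAt_integral_of_contDiff {E F : Type u} [NormedAddCommGroup E] [NormedSpace ℝ E]
    [FiniteDimensional ℝ E] [NormedAddCommGroup F] [NormedSpace ℝ F]
    {f : E → ℝ → F} (hf : ContDiff ℝ ∞ (Function.uncurry f)) (x : E) :
    HasFDerivAt (fun x => ∫ t in (0 : ℝ)..1, f x t)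
      (∫ t in (0 : ℝ)..1, fderiv ℝ (fun y => f y t) x) x := by
  have hd : Continuous fun p : E × ℝ => fderiv ℝ (fun y => f y p.2) p.1 := by
    have h : ContDiff ℝ ∞ fun p : E × ℝ => fderiv ℝ (fun y => f y p.2) p.1 :=
      ContDiff.fderiv (f := fun (p : E × ℝ) y => f y p.2) (m := ∞)
        (hf.comp (contDiff_snd.prodMk (contDiff_snd.comp contDiff_fst))) contDiff_fst le_rfl
    exact h.continuous
  have : ProperSpace E := FiniteDimensional.proper ℝ E
  obtain ⟨C, hC⟩ := ((isCompact_closedBall x 1).prod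
    (isCompact_Icc (a := (0 : ℝ)) (b := 1))).exists_bound_of_continuousOn hd.continuousOn
  have hcont : Continuous (Function.uncurry f) := hf.continuous
  have hy : ∀ y, Continuous (f y) := fun y => hcont.comp (by fun_prop : Continuous fun t => (y, t))
  refine intervalIntegral.hasFDerivAt_integral_of_dominated_of_fderiv_le
    (F' := fun y t => fderiv ℝ (fun z => f z t) y) (bound := fun _ => C)
    (Metric.closedBall_mem_nhds x one_pos)
    (.of_forall fun y => (hy y).aestronglyMeasurable) ((hy x).intervalIntegrable _ _)
    (hd.comp (by fun_prop : Continuous fun t : ℝ => (x, t))).aestronglyMeasurable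
    (.of_forall fun t ht y hyx => hC (y, t) ⟨hyx, ?_⟩) intervalIntegrable_const
    (.of_forall fun t _ y _ => ?_)
  · rw [Set.uIoc_of_le zero_le_one] at ht
    exact ⟨ht.1.le, ht.2⟩
  · refine DifferentiableAt.hasFDerivAt (ContDiff.differentiable (n := ∞) ?_ (by simp) y)
    exact hf.comp (contDiff_id.prodMk contDiff_const)

/-- The derivative is an integral of the same kind with values in `E →L[ℝ] F`, so the induction
varies `F`; for this `E` and `F` share a universe. -/
theorem contDiff_nat_integral {E F : Type u} [NormedAddCommGroup E] [NormedSpace ℝ E]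
    [FiniteDimensional ℝ E] [NormedAddCommGroup F] [NormedSpace ℝ F] (n : ℕ)
    {f : E → ℝ → F} (hf : ContDiff ℝ ∞ (Function.uncurry f)) :
    ContDiff ℝ n fun x => ∫ t in (0 : ℝ)..1, f x t := by
  induction n generalizing F with
  | zero =>
    exact contDiff_zero.2
      (intervalIntegral.continuous_parametric_intervalIntegral_of_continuous' hf.continuous 0 1)
  | succ n ih =>
    push_cast
    rw [contDiff_succ_iff_hasFDerivAt]
    refine ⟨_, ih ?_, hasFDerivAt_integral_of_contDiff hf⟩
    exact ContDiff.fderiv (f := fun (p : E × ℝ) y => f y p.2) (m := ∞)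
        (hf.comp (contDiff_snd.prodMk (contDiff_snd.comp contDiff_fst))) contDiff_fst le_rfl

theorem contDiff_integral {E F : Type u} [NormedAddCommGroup E] [NormedSpace ℝ E]
    [FiniteDimensional ℝ E] [NormedAddCommGroup F] [NormedSpace ℝ F]
    {f : E → ℝ → F} (hf : ContDiff ℝ ∞ (Function.uncurry f)) :
    ContDiff ℝ ∞ fun x => ∫ t in (0 : ℝ)..1, f x t :=
  contDiff_infty.2 fun n => contDiff_nat_integral n hf

/-- The fundamental theorem of calculus along the segment from `w` to `u`; it has no singularity at
`u = w`, hence gives smoothness. -/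
theorem divDiff_eq_integral (f : 𝓢(ℝ, ℂ)) (u w : ℝ) :
    divDiff f u w =
      ∫ θ in (0 : ℝ)..1, SchwartzMap.derivCLM ℂ ℂ f (θ * u + (1 - θ) * w) := by
  rcases eq_or_ne w u with rfl | h
  · have : ∀ θ : ℝ, θ * w + (1 - θ) * w = w := fun θ => by ring
    simp [divDiff, dslope_same, this]
  · have hd : ∀ θ ∈ Set.uIcc (0 : ℝ) 1,
        HasDerivAt (fun θ : ℝ => (u - w)⁻¹ • f (θ * u + (1 - θ) * w))
          (SchwartzMap.derivCLM ℂ ℂ f (θ * u + (1 - θ) * w)) θ := fun θ _ => by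
      have h1 : HasDerivAt (fun θ : ℝ => θ * u + (1 - θ) * w) (u - w) θ :=
        (((hasDerivAt_id θ).mul_const u).add
          (((hasDerivAt_id θ).const_sub 1).mul_const w)).congr_deriv (by ring)
      refine (((f.differentiableAt (x := θ * u + (1 - θ) * w)).hasDerivAt.scomp θ
        h1).const_smul (u - w)⁻¹).congr_deriv ?_
      rw [smul_smul, inv_mul_cancel₀ (sub_ne_zero.2 h.symm), one_smul,
        SchwartzMap.derivCLM_apply]
    rw [intervalIntegral.integral_eq_sub_of_hasDerivAt hd
      (Continuous.intervalIntegrable (by fun_prop) _ _), divDiff, dslope_of_ne _ h, slope_comm,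
      slope, vsub_eq_sub, smul_sub]
    simp

theorem contDiff_divDiff {E : Type} [NormedAddCommGroup E] [NormedSpace ℝ E]
    [FiniteDimensional ℝ E] (f : 𝓢(ℝ, ℂ)) {u w : E → ℝ} (hu : ContDiff ℝ ∞ u)
    (hw : ContDiff ℝ ∞ w) : ContDiff ℝ ∞ fun x => divDiff f (u x) (w x) := by
  simp only [divDiff_eq_integral]
  refine contDiff_integral (f := fun x θ =>
    SchwartzMap.derivCLM ℂ ℂ f (θ * u x + (1 - θ) * w x)) ?_
  refine ((SchwartzMap.derivCLM ℂ ℂ f).smooth ⊤).comp ?_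
  have hu' := hu.comp (contDiff_fst (𝕜 := ℝ) (E := E) (F := ℝ))
  have hw' := hw.comp (contDiff_fst (𝕜 := ℝ) (E := E) (F := ℝ))
  exact (contDiff_snd.mul hu').add ((contDiff_const.sub contDiff_snd).mul hw')

theorem _root_.SchwartzMap.fourier_derivCLM (f : 𝓢(ℝ, ℂ)) (ξ : ℝ) :
    (𝓕 (SchwartzMap.derivCLM ℂ ℂ f)) ξ = 2 * π * Complex.I * ξ * (𝓕 f) ξ := by
  have h : (SchwartzMap.derivCLM ℂ ℂ f : ℝ → ℂ) = deriv f :=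
    funext fun x => SchwartzMap.derivCLM_apply ℂ f x
  have h2 := Real.fourier_deriv f.integrable f.differentiable
    (h ▸ (SchwartzMap.derivCLM ℂ ℂ f).integrable)
  rw [SchwartzMap.fourier_coe, h, h2, SchwartzMap.fourier_coe]
  simp only [smul_eq_mul]

/-- The product of the Lebesgue measures on the real line and on the unit interval. -/
abbrev stripMeasure : Measure (ℝ × ℝ) :=
  (volume : Measure ℝ).prod (volume.restrict (Set.Ioc 0 1))

theorem divDiff_eq_integral_fourier (f : 𝓢(ℝ, ℂ)) (u w : ℝ) :
    divDiff f u w = ∫ p : ℝ × ℝ, (𝓕 (SchwartzMap.derivCLM ℂ ℂ f)) p.1 *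
      Complex.exp (2 * π * Complex.I * p.1 * ((p.2 * u + (1 - p.2) * w : ℝ) : ℂ))
        ∂stripMeasure := by
  set f' := SchwartzMap.derivCLM ℂ ℂ f
  have hF := (𝓕 f').continuous
  have hi : Integrable (fun p : ℝ × ℝ => (𝓕 f') p.1 *
      Complex.exp (2 * π * Complex.I * p.1 * ((p.2 * u + (1 - p.2) * w : ℝ) : ℂ)))
        stripMeasure := by
    refine ((𝓕 f').integrable.norm.comp_fst (volume.restrict (Set.Ioc (0 : ℝ) 1))).mono'
      (Continuous.aestronglyMeasurable (by fun_prop)) (.of_forall fun p => ?_)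
    rw [norm_mul, norm_cexp_two_pi_mul, mul_one]
  rw [integral_prod_symm _ hi]
  simp only [SchwartzMap.integral_fourier_mul_cexp]
  rw [divDiff_eq_integral, intervalIntegral.integral_of_le zero_le_one]

end

/-! ### Contractions as integrals, and differentiation under the integral -/

section

variable {A : Type*} [CStarAlgebra A]

theorem contractMultilinear_one_apply (x : A) (v : Fin 2 → A) :
    contractMultilinear ![x] v = v 0 * x * v 1 := by
  simp [contractMultilinear, List.ofFn_succ, Fin.snoc]

theorem contractMultilinear_two_apply (x y : A) (v : Fin 3 → A) :
    contractMultilinear ![x, y] v = v 0 * x * v 1 * y * v 2 := by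
  simp [contractMultilinear, List.ofFn_succ, Fin.snoc, mul_assoc]

theorem contract_nablaCalc_one {c : A} (hc : IsSelfAdjoint c) (x : A) (f : 𝓢(ℝ, ℂ)) :
    contract ![x] (nablaCalc c fun s : Fin 1 → ℝ => f (s 0)) =
      ∫ ξ : ℝ, (𝓕 f) ξ • (expGroup c (-ξ) * x * expGroup c ξ) := by
  -- The frequencies `(-ξ, ξ)` come from `ξ(t₁ - t₀)`.
  rw [nablaCalc, contract_smoothCalc hc (μ := (volume : Measure ℝ)) (g := fun ξ => (𝓕 f) ξ)
    (η := fun ξ => ![-ξ, ξ]) ![x] ?_ (𝓕 f).integrable (by fun_prop) fun t => ?_]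
  · simp [contractMultilinear_one_apply]
  · exact (f.smooth ⊤).comp (by fun_prop)
  · rw [← SchwartzMap.integral_fourier_mul_cexp]
    refine integral_congr_ae (.of_forall fun ξ => ?_)
    refine Eq.trans ?_ (congrArg ((𝓕 f) ξ * ·) (Fin.prod_univ_two (M := ℂ) _)).symm
    simp only [← Complex.exp_add]
    congr 2
    simp
    ring

/-- The sign `σ = ±1` treats both divided differences of the claim at once. -/
theorem contract_nablaCalc_divDiff {a : A} (ha : IsSelfAdjoint a) (x y : A) (f : 𝓢(ℝ, ℂ))
    (σ : ℝ) :
    contract ![x, y] (nablaCalc a fun s : Fin 2 → ℝ => divDiff f (σ * s 0) (-(σ * s 1))) =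
      ∫ p : ℝ × ℝ, (𝓕 (SchwartzMap.derivCLM ℂ ℂ f)) p.1 •
        (expGroup a (-(σ * (p.2 * p.1))) * x * expGroup a (σ * p.1) * y *
          expGroup a (-(σ * ((1 - p.2) * p.1)))) ∂stripMeasure := by
  -- The frequencies are the coefficients of `t₀, t₁, t₂` in `ξσ(θ(t₁ - t₀) - (1-θ)(t₂ - t₁))`; that
  -- of `t₁` is free of `θ`.
  rw [nablaCalc, contract_smoothCalc ha (μ := stripMeasure)
    (g := fun p => (𝓕 (SchwartzMap.derivCLM ℂ ℂ f)) p.1)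
    (η := fun p => ![-(σ * (p.2 * p.1)), σ * p.1, -(σ * ((1 - p.2) * p.1))]) ![x, y] ?_
    ((𝓕 (SchwartzMap.derivCLM ℂ ℂ f)).integrable.comp_fst _) (by fun_prop) fun t => ?_]
  · simp [contractMultilinear_two_apply]
  · exact contDiff_divDiff f (by fun_prop) (by fun_prop)
  · rw [divDiff_eq_integral_fourier]
    refine integral_congr_ae (.of_forall fun p => ?_)
    refine Eq.trans ?_ (congrArg ((𝓕 (SchwartzMap.derivCLM ℂ ℂ f)) p.1 * ·)
      (Fin.prod_univ_three (M := ℂ) _)).symm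
    simp only [← Complex.exp_add]
    congr 2
    simp
    ring

theorem norm_mul_expGroup_triple_le {c : A} (hc : IsSelfAdjoint c) (x : A) (s t : ℝ) :
    ‖expGroup c s * x * expGroup c t‖ ≤ ‖x‖ := by
  calc _ ≤ ‖expGroup c s‖ * ‖x‖ * ‖expGroup c t‖ := norm_mul₃_le
    _ ≤ 1 * ‖x‖ * 1 := by
      gcongr
      · exact norm_expGroup_le_one hc _
      · exact norm_expGroup_le_one hc _
    _ = ‖x‖ := by ring

/-- The derivative of `ε ↦ exp (2πi s (a + ε b))` at `0`. -/
def expGroupDeriv (a b : A) (s : ℝ) : A :=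
  ∫ θ in (0 : ℝ)..1, (2 * π * Complex.I * s : ℂ) •
    (expGroup a ((1 - θ) * s) * b * expGroup a (θ * s))

@[fun_prop]
theorem continuous_expGroupDeriv (a b : A) : Continuous (expGroupDeriv a b) :=
  intervalIntegral.continuous_parametric_intervalIntegral_of_continuous' (by fun_prop) 0 1

/-- Substituting `u = 1 - θ` in Duhamel's integral makes `θ` match the parameter of the divided
difference once the trace has been cycled. -/
theorem hasDerivAt_expGroup_perturb (a b : A) (s : ℝ) :
    HasDerivAt (fun ε : ℝ => expGroup (a + ε • b) s) (expGroupDeriv a b s) 0 := by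
  refine (hasDerivAt_expGroup_add_smul a b s).congr_deriv ?_
  have h := intervalIntegral.integral_comp_sub_left (a := 0) (b := 1)
    (fun θ : ℝ => (2 * π * Complex.I * s : ℂ) •
      (expGroup a ((1 - θ) * s) * b * expGroup a (θ * s))) 1
  simpa [expGroupDeriv] using h

theorem isSelfAdjoint_add_smul {a b : A} (ha : IsSelfAdjoint a) (hb : IsSelfAdjoint b) (ε : ℝ) :
    IsSelfAdjoint (a + ε • b) :=
  ha.add ((IsSelfAdjoint.all ε).smul hb)

theorem lipschitz_expGroup_conj {a b : A} (ha : IsSelfAdjoint a) (hb : IsSelfAdjoint b) (x : A)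
    (s t ε δ : ℝ) :
    ‖expGroup (a + ε • b) s * x * expGroup (a + ε • b) t -
      expGroup (a + δ • b) s * x * expGroup (a + δ • b) t‖ ≤
        2 * π * (|s| + |t|) * ‖b‖ * ‖x‖ * |ε - δ| := by
  have hε := isSelfAdjoint_add_smul ha hb ε
  have hδ := isSelfAdjoint_add_smul ha hb δ
  have hE : ∀ r, ‖expGroup (a + ε • b) r - expGroup (a + δ • b) r‖ ≤
      2 * π * |r| * (|ε - δ| * ‖b‖) := fun r => by
    have h := norm_expGroup_sub_le hδ hε r
    rwa [add_sub_add_left_eq_sub, ← sub_smul, norm_smul, Real.norm_eq_abs] at h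
  calc _ = ‖(expGroup (a + ε • b) s - expGroup (a + δ • b) s) * x * expGroup (a + ε • b) t +
        expGroup (a + δ • b) s * x * (expGroup (a + ε • b) t - expGroup (a + δ • b) t)‖ := by
        congr 1
        noncomm_ring
    _ ≤ ‖expGroup (a + ε • b) s - expGroup (a + δ • b) s‖ * ‖x‖ * ‖expGroup (a + ε • b) t‖ +
        ‖expGroup (a + δ • b) s‖ * ‖x‖ * ‖expGroup (a + ε • b) t - expGroup (a + δ • b) t‖ :=
        (norm_add_le _ _).trans (add_le_add norm_mul₃_le norm_mul₃_le)
    _ ≤ 2 * π * |s| * (|ε - δ| * ‖b‖) * ‖x‖ * 1 + 1 * ‖x‖ * (2 * π * |t| * (|ε - δ| * ‖b‖)) := by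
        gcongr
        · exact hE s
        · exact norm_expGroup_le_one hε t
        · exact norm_expGroup_le_one hδ s
        · exact hE t
    _ = _ := by ring

theorem hasDerivAt_integral_expGroup_conj {a b : A} (ha : IsSelfAdjoint a) (hb : IsSelfAdjoint b)
    (x : A) (f : 𝓢(ℝ, ℂ)) :
    Integrable (fun ξ => (𝓕 f) ξ • (expGroupDeriv a b (-ξ) * x * expGroup a ξ +
      expGroup a (-ξ) * x * expGroupDeriv a b ξ)) ∧
    HasDerivAt (fun ε : ℝ => ∫ ξ : ℝ,
        (𝓕 f) ξ • (expGroup (a + ε • b) (-ξ) * x * expGroup (a + ε • b) ξ))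
      (∫ ξ : ℝ, (𝓕 f) ξ • (expGroupDeriv a b (-ξ) * x * expGroup a ξ +
        expGroup a (-ξ) * x * expGroupDeriv a b ξ)) 0 := by
  have hF := (𝓕 f).continuous
  -- The Lipschitz constant in `ε` is `2π(|-ξ| + |ξ|)‖b‖‖x‖‖f̂(ξ)‖`. Since `2π|ξ|‖f̂(ξ)‖` is the
  -- norm of the transform of `f'`, this is the stated bound.
  refine hasDerivAt_integral_of_dominated_loc_of_lip (s := Set.univ)
    (bound := fun ξ => ‖(𝓕 (SchwartzMap.derivCLM ℂ ℂ f)) ξ‖ * (2 * ‖b‖ * ‖x‖)) Filter.univ_mem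
    (.of_forall fun ε => (by fun_prop : Continuous _).aestronglyMeasurable)
    ?_ (by fun_prop : Continuous _).aestronglyMeasurable (.of_forall fun ξ => ?_)
    ((𝓕 (SchwartzMap.derivCLM ℂ ℂ f)).integrable.norm.mul_const _) (.of_forall fun ξ => ?_)
  · refine ((𝓕 f).integrable.norm.mul_const ‖x‖).mono'
      (by fun_prop : Continuous _).aestronglyMeasurable (.of_forall fun ξ => ?_)
    rw [norm_smul]
    gcongr
    exact norm_mul_expGroup_triple_le (isSelfAdjoint_add_smul ha hb 0) x _ _
  · refine LipschitzOnWith.of_dist_le_mul fun ε _ δ _ => ?_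
    rw [Real.coe_nnabs, abs_of_nonneg (by positivity), dist_eq_norm, dist_eq_norm, ← smul_sub,
      norm_smul, SchwartzMap.fourier_derivCLM, norm_mul, Real.norm_eq_abs (ε - δ)]
    refine (mul_le_mul_of_nonneg_left (lipschitz_expGroup_conj ha hb x _ _ ε δ)
      (norm_nonneg _)).trans_eq ?_
    simp [abs_of_pos Real.pi_pos]
    ring
  · have h1 := hasDerivAt_expGroup_perturb a b (-ξ)
    have h2 := hasDerivAt_expGroup_perturb a b ξ
    have h := ((h1.mul_const x).mul h2).const_smul ((𝓕 f) ξ)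
    exact h.congr_deriv (by simp)

/-- The linear functional `z ↦ φ (z y)`. -/
def IsTracialState.mulRightCLM {φ : A →ₗ[ℂ] ℂ} (hφ : IsTracialState φ) (y : A) : A →L[ℂ] ℂ :=
  (⟨φ, hφ.continuous⟩ : A →L[ℂ] ℂ).comp ((ContinuousLinearMap.mul ℂ A).flip y)

/-- The linear functional `z ↦ φ (b z)`. -/
def IsTracialState.mulLeftCLM {φ : A →ₗ[ℂ] ℂ} (hφ : IsTracialState φ) (b : A) : A →L[ℂ] ℂ :=
  (⟨φ, hφ.continuous⟩ : A →L[ℂ] ℂ).comp (ContinuousLinearMap.mul ℂ A b)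

theorem IsTracialState.mulRightCLM_apply {φ : A →ₗ[ℂ] ℂ} (hφ : IsTracialState φ) (y z : A) :
    hφ.mulRightCLM y z = φ (z * y) := rfl

theorem IsTracialState.mulLeftCLM_apply {φ : A →ₗ[ℂ] ℂ} (hφ : IsTracialState φ) (b z : A) :
    hφ.mulLeftCLM b z = φ (b * z) := rfl

theorem IsTracialState.apply_expGroupDeriv_mul {φ : A →ₗ[ℂ] ℂ} (hφ : IsTracialState φ)
    (a b z : A) (s : ℝ) :
    φ (expGroupDeriv a b s * z) = ∫ θ in Set.Ioc (0 : ℝ) 1, (2 * π * Complex.I * s : ℂ) *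
      φ (b * (expGroup a (θ * s) * z * expGroup a ((1 - θ) * s))) := by
  rw [← hφ.mulRightCLM_apply, expGroupDeriv, intervalIntegral.integral_of_le zero_le_one,
    ← ContinuousLinearMap.integral_comp_comm]
  · refine integral_congr_ae (.of_forall fun θ => ?_)
    simp only [map_smul, smul_eq_mul]
    simp only [hφ.mulRightCLM_apply]
    -- Traciality moves the exponential left of `b` to the far right.
    rw [mul_assoc, mul_assoc (expGroup a _) b, mul_assoc (expGroup a _) _ z, hφ.tracial]
    simp only [mul_assoc]
  · exact (Continuous.integrableOn_Icc (by fun_prop)).mono_set Set.Ioc_subset_Icc_self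

/-- The trace of `b` times the contraction of a divided difference, as an iterated integral. -/
theorem IsTracialState.apply_mul_contract_divDiff {φ : A →ₗ[ℂ] ℂ} (hφ : IsTracialState φ) {a : A}
    (ha : IsSelfAdjoint a) (b x y : A) (f : 𝓢(ℝ, ℂ)) (σ : ℝ) :
    Integrable (fun ξ : ℝ => ∫ θ in Set.Ioc (0 : ℝ) 1,
      (𝓕 (SchwartzMap.derivCLM ℂ ℂ f)) ξ *
        φ (b * (expGroup a (-(σ * (θ * ξ))) * x * expGroup a (σ * ξ) * y *
          expGroup a (-(σ * ((1 - θ) * ξ)))))) ∧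
    φ (b * contract ![x, y]
        (nablaCalc a fun s : Fin 2 → ℝ => divDiff f (σ * s 0) (-(σ * s 1)))) =
      ∫ ξ : ℝ, ∫ θ in Set.Ioc (0 : ℝ) 1, (𝓕 (SchwartzMap.derivCLM ℂ ℂ f)) ξ *
        φ (b * (expGroup a (-(σ * (θ * ξ))) * x * expGroup a (σ * ξ) * y *
          expGroup a (-(σ * ((1 - θ) * ξ))))) := by
  have hF := (𝓕 (SchwartzMap.derivCLM ℂ ℂ f)).continuous
  have hi : Integrable (fun p : ℝ × ℝ => (𝓕 (SchwartzMap.derivCLM ℂ ℂ f)) p.1 •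
        (expGroup a (-(σ * (p.2 * p.1))) * x * expGroup a (σ * p.1) * y *
          expGroup a (-(σ * ((1 - p.2) * p.1))))) stripMeasure := by
    refine (((𝓕 (SchwartzMap.derivCLM ℂ ℂ f)).integrable.norm.mul_const (‖x‖ * ‖y‖)).comp_fst
      (volume.restrict (Set.Ioc (0 : ℝ) 1))).mono'
      (Continuous.aestronglyMeasurable (by fun_prop)) (.of_forall fun p => ?_)
    rw [norm_smul]
    gcongr
    rw [mul_assoc (_ * expGroup a (σ * p.1)) y]
    refine (norm_mul_le _ _).trans ?_
    gcongr
    · exact norm_mul_expGroup_triple_le ha x _ _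
    · exact (norm_mul_le _ _).trans
        (mul_le_of_le_one_right (norm_nonneg _) (norm_expGroup_le_one ha _))
  have hi' := (hφ.mulLeftCLM b).integrable_comp hi
  rw [contract_nablaCalc_divDiff ha, ← hφ.mulLeftCLM_apply,
    ← ContinuousLinearMap.integral_comp_comm _ hi]
  simp only [map_smul, smul_eq_mul] at hi' ⊢
  simp only [hφ.mulLeftCLM_apply] at hi' ⊢
  exact ⟨hi'.integral_prod_left, integral_prod _ hi'⟩

theorem neg_divDiff_neg (f : ℝ → ℂ) {s t : ℝ} (h : s + t ≠ 0) :
    -divDiff f s (-t) = (f (-t) - f s) / (s + t) := by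
  have hne : -t ≠ s := fun h' => h (by rw [← h']; ring)
  have hc : (s + t : ℂ) ≠ 0 := by exact_mod_cast h
  rw [divDiff, dslope_of_ne _ hne, slope, vsub_eq_sub, Complex.real_smul]
  push_cast
  rw [show (-t - s : ℂ) = -(s + t) by ring, inv_neg]
  field_simp

theorem divDiff_neg (f : ℝ → ℂ) {s t : ℝ} (h : s + t ≠ 0) :
    divDiff f (-s) t = (f t - f (-s)) / (s + t) := by
  have hne : t ≠ -s := fun h' => h (by rw [h']; ring)
  rw [divDiff, dslope_of_ne _ hne, slope, vsub_eq_sub, Complex.real_smul]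
  push_cast
  rw [show (t - -s : ℂ) = s + t by ring, div_eq_inv_mul]

end

/-! ### Matching the derivative with the two divided differences -/

section

variable {A : Type*} [CStarAlgebra A]

theorem IsTracialState.apply_integral_expGroupDeriv {φ : A →ₗ[ℂ] ℂ} (hφ : IsTracialState φ)
    {a b : A} (ha : IsSelfAdjoint a) (hb : IsSelfAdjoint b) (x y : A) (f : 𝓢(ℝ, ℂ)) :
    φ ((∫ ξ : ℝ, (𝓕 f) ξ • (expGroupDeriv a b (-ξ) * x * expGroup a ξ +
        expGroup a (-ξ) * x * expGroupDeriv a b ξ)) * y) =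
      -φ (b * contract ![x, y]
          (nablaCalc a fun s : Fin 2 → ℝ => divDiff f (s 0) (-s 1)))
        + φ (b * contract ![y, x]
          (nablaCalc a fun s : Fin 2 → ℝ => divDiff f (-s 0) (s 1))) := by
  -- Differentiating the left exponential, at `s = -ξ`, yields the term with `σ = 1` and its minus
  -- sign; the right one, at `s = ξ`, yields `σ = -1` with `x` and `y` exchanged by the trace.
  have h1 := hφ.apply_mul_contract_divDiff ha b x y f 1
  have h2 := hφ.apply_mul_contract_divDiff ha b y x f (-1)
  simp only [one_mul, neg_mul, neg_neg] at h1 h2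
  rw [h1.2, h2.2, neg_add_eq_sub, ← integral_sub h2.1 h1.1, ← hφ.mulRightCLM_apply,
    ← ContinuousLinearMap.integral_comp_comm _
      (hasDerivAt_integral_expGroup_conj ha hb x f).1]
  refine integral_congr_ae (.of_forall fun ξ => ?_)
  simp only [map_smul, smul_eq_mul]
  rw [hφ.mulRightCLM_apply, add_mul, map_add, mul_assoc (expGroupDeriv a b (-ξ) * x),
    mul_assoc (expGroupDeriv a b (-ξ)), mul_assoc (expGroup a (-ξ) * x),
    hφ.tracial (expGroup a (-ξ) * x), mul_assoc (expGroupDeriv a b ξ),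
    hφ.apply_expGroupDeriv_mul, hφ.apply_expGroupDeriv_mul, mul_add, ← neg_add_eq_sub,
    ← integral_const_mul, ← integral_const_mul, ← integral_neg]
  congr 1 <;> refine integral_congr_ae (.of_forall fun θ => ?_) <;>
    simp only [SchwartzMap.fourier_derivCLM, mul_neg, mul_assoc, Complex.ofReal_neg] <;> ring

end

end NablaCalculus

end

theorem mainTheorem8 {A : Type*} [CStarAlgebra A] (φ : A →ₗ[ℂ] ℂ)
    (hφ : NablaCalculus.IsTracialState φ) (f : 𝓢(ℝ, ℂ)) (a b x y : A)
    (ha : IsSelfAdjoint a) (hb : IsSelfAdjoint b) (hx : IsSelfAdjoint x)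
    (hy : IsSelfAdjoint y) :
    HasDerivAt
      (fun ε : ℝ => φ (NablaCalculus.contract ![x]
        (NablaCalculus.nablaCalc (a + ε • b) fun s : Fin 1 → ℝ => f (s 0)) * y))
      (-φ (b * NablaCalculus.contract ![x, y]
          (NablaCalculus.nablaCalc a fun s : Fin 2 → ℝ =>
            NablaCalculus.divDiff f (s 0) (-s 1)))
        + φ (b * NablaCalculus.contract ![y, x]
          (NablaCalculus.nablaCalc a fun s : Fin 2 → ℝ =>
            NablaCalculus.divDiff f (-s 0) (s 1)))) 0
    ∧ ∀ s t : ℝ, s + t ≠ 0 →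
      -NablaCalculus.divDiff f s (-t) = (f (-t) - f s) / (s + t) ∧
      NablaCalculus.divDiff f (-s) t = (f t - f (-s)) / (s + t) := by
  refine ⟨?_, fun s t h => ⟨NablaCalculus.neg_divDiff_neg f h, NablaCalculus.divDiff_neg f h⟩⟩
  have hD := (NablaCalculus.hasDerivAt_integral_expGroup_conj ha hb x f).2
  -- The parameter `ε` is real, so the complex functional is composed as a real-linear one.
  have h := ((hφ.mulRightCLM y).restrictScalars ℝ).hasFDerivAt.comp_hasDerivAt 0 hD
  rw [← hφ.apply_integral_expGroupDeriv ha hb x y f]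
  refine h.congr_of_eventuallyEq (.of_forall fun ε => ?_)
  simp only
  rw [NablaCalculus.contract_nablaCalc_one
    (NablaCalculus.isSelfAdjoint_add_smul ha hb ε)]
  rfl
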